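/- Let $1\le d<D$ be integers, let $\mathcal X\subseteq\mathbb R^D$, and let $f:\mathcal X\to\mathbb R$ be Lipschitz continuous with constant $L>0$, i.e. $|f(x)-f(y)|\le L\|x-y\|$ for all $x,y\in\mathcal X$, where $\|\cdot\|$ is the Euclidean norm. Let $\epsilon>0$ and let $x^*\in\mathcal X$ be a global minimizer of $f$ on $\mathcal X$, with $f^*=f(x^*)=\min_{\mathcal X}f$, such that the ball $B_{\epsilon/L}(x^*)=\{x\in\mathbb R^D:\|x-x^*\|<\epsilon/L\}$ is contained in $\mathcal X$. Let $A$ be a random $D\times d$ matrix whose entries are independent standard normal variables. For $p\in\mathcal X$, the reduced problem $$\min_{y\in\mathbb R^d} f(Ay+p)\quad\text{subject to}\quad Ay+p\in\mathcal X$$ is called $\epsilon$-successful if there is $y\in\mathbb R^d$ with $Ay+p\in\mathcal X$ and $f(Ay+p)\le f^*+\epsilon$. For $0<r<1$ put $$\tau(r,d,D)=\begin{cases}(D-1)\dbinom{\frac{D-2}{2}}{\frac{D-1}{2}}\displaystyle\int_0^{\arcsin r}\sin^{D-2}(x)\,dx & \text{if } d=1,\\[2ex] \dbinom{\frac{D-2}{2}}{\frac{D-d}{2}}\,r^{D-d}(1-r^2)^{\frac{d-2}{2}}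 & \text{if } 1<d<D,\end{cases}\qquad \binom{i}{j}=\frac{\Gamma(i+1)}{\Gamma(j+1)\,\Gamma(i-j+1)}.$$ Let $R_{\max}>0$ be a constant such that $r_{\min}:=\epsilon/(L R_{\max})<1$. Then for every $p\in\mathcal X$ with $\|p-x^*\|<R_{\max}$ (including $p$ arbitrarily close or equal to $x^*$), $$\mathbb P[\text{the reduced problem is } \epsilon\text{-successful}]\ \ge\ \tau(r_{\min},d,D).$$ -/

import Mathlib

open MeasureTheory ProbabilityTheory
open scoped NNReal Matrix

noncomputable section

/-- A random `D × d` matrix whose entries are independent standard normal variables. -/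
structure IsGaussianMatrix {Ω : Type*} [MeasurableSpace Ω] {D d : ℕ}
    (A : Ω → Matrix (Fin D) (Fin d) ℝ) (P : Measure Ω) : Prop where
  hasLaw_entry : ∀ i j, HasLaw (fun ω => A ω i j) (gaussianReal 0 1) P
  iIndepFun_entries : iIndepFun (fun (ij : Fin D × Fin d) ω => A ω ij.1 ij.2) P

/-- `x` is a global minimizer of `f` over the feasible set `X`. -/
def IsGlobalMinimizer {D : ℕ} (f : EuclideanSpace ℝ (Fin D) → ℝ)
    (X : Set (EuclideanSpace ℝ (Fin D))) (x : EuclideanSpace ℝ (Fin D)) : Prop :=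
  x ∈ X ∧ IsMinOn f X x

/-- The optimal value `f^*` of minimizing `f` over `X`, which is the minimum of `f` on `X` whenever
a global minimizer exists. -/
def optimalValue {D : ℕ} (f : EuclideanSpace ℝ (Fin D) → ℝ)
    (X : Set (EuclideanSpace ℝ (Fin D))) : ℝ :=
  sInf (f '' X)

/-- The reduced problem `min_y f (A y + p)` subject to `A y + p ∈ X` is `ε`-successful: some feasible
`y` satisfies `f (A y + p) ≤ f^* + ε`. -/
def ReducedProblemSuccessful {D d : ℕ} (f : EuclideanSpace ℝ (Fin D) → ℝ)
    (X : Set (EuclideanSpace ℝ (Fin D))) (A : Matrix (Fin D) (Fin d) ℝ)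
    (p : EuclideanSpace ℝ (Fin D)) (ε : ℝ) : Prop :=
  ∃ y : Fin d → ℝ, WithLp.toLp 2 (A *ᵥ y) + p ∈ X ∧
    f (WithLp.toLp 2 (A *ᵥ y) + p) ≤ optimalValue f X + ε

/-- The binomial coefficient extended to real arguments through the Gamma function. -/
def gammaBinom (i j : ℝ) : ℝ :=
  Real.Gamma (i + 1) / (Real.Gamma (j + 1) * Real.Gamma (i - j + 1))

/-- The function `τ(r, d, D)`, meaningful for `0 < r < 1` and `1 ≤ d < D`. -/
def tau (r : ℝ) (d D : ℕ) : ℝ :=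
  if d = 1 then
    ((D : ℝ) - 1) * gammaBinom (((D : ℝ) - 2) / 2) (((D : ℝ) - 1) / 2) *
      ∫ x in (0 : ℝ)..Real.arcsin r, Real.sin x ^ (D - 2)
  else
    gammaBinom (((D : ℝ) - 2) / 2) (((D : ℝ) - d) / 2) * r ^ (D - d) *
      (1 - r ^ 2) ^ (((d : ℝ) - 2) / 2)

end

/-!
The reduced problem succeeds as soon as the affine subspace `p + range A` meets the ball of radius
`ε / L` around the minimizer `x*`. With `v = x* - p` and `‖v‖ < Rmax`, it is enough that some vector of
`range A` is at distance less than `r * ‖v‖` from `v`, where `r = ε / (L * Rmax)`. For `v ≠ 0` this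
says that the angle between `v` and the random subspace `range A` is less than `arcsin r`, an event
whose probability depends neither on `p` nor on `f` and can be computed exactly.

The columns of `A` are independent standard Gaussian vectors, a law invariant under isometries, so
the probability is the same for all `v ≠ 0` (`measure_isNearSpan_eq`). It may therefore be averaged
over a standard Gaussian `v` independent of `A`. By Fubini's theorem, `A` can then be held fixed and
`v` be random; since `range A` almost surely has dimension `d`
(`ae_linearIndependent_pi_stdGaussian`), what remains is the probability that a standard Gaussian
vector in `ℝ ^ D` makes an angle less than `arcsin r` with a fixed subspace `W` of dimension `d`. The
norms of the components along `W` and `Wᗮ` are independent chi variables with `d` and `D - d` degrees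
of freedom (`map_norm_orthogonalProjection_stdGaussian`). Polar coordinates in the plane of these two
norms separate their joint density (`mul_chiDensity_mul_chiDensity`) and give the probability as a
multiple of `∫ θ in 0..arcsin r, sin θ ^ (D - d - 1) * cos θ ^ (d - 1)` (`sectorProb`).

For `d = 1` this is `tau`. For `2 ≤ d` the bound `cos θ ^ (d - 2) ≥ (1 - r ^ 2) ^ ((d - 2) / 2)` on the
range of integration leaves an elementary integral, and its value is `tau` (`tau_le_sectorProb`).
-/

section

open Module Set

/-! ### The standard Gaussian measure in polar coordinates -/

/-- Polar coordinates for a radial function: the counterpart of `integral_fun_norm_addHaar` for the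
lower Lebesgue integral. -/
theorem lintegral_fun_norm_addHaar {E : Type*} [NormedAddCommGroup E] [NormedSpace ℝ E]
    [FiniteDimensional ℝ E] [Nontrivial E] [MeasurableSpace E] [BorelSpace E]
    (μ : Measure E) [μ.IsAddHaarMeasure] {f : ℝ → ENNReal} (hf : Measurable f) :
    ∫⁻ x, f ‖x‖ ∂μ = finrank ℝ E * μ (Metric.ball 0 1) *
      ∫⁻ s in Ioi (0 : ℝ), ENNReal.ofReal (s ^ (finrank ℝ E - 1)) * f s := by
  calc
    ∫⁻ x, f ‖x‖ ∂μ = ∫⁻ x : ({(0)}ᶜ : Set E), f ‖x.1‖ ∂(μ.comap (↑)) := by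
      rw [lintegral_subtype_comap (measurableSet_singleton _).compl fun x ↦ f ‖x‖,
        restrict_compl_singleton]
    _ = ∫⁻ x, f x.2 ∂μ.toSphere.prod (.volumeIoiPow (finrank ℝ E - 1)) := by
      simpa using μ.measurePreserving_homeomorphUnitSphereProd.lintegral_comp_emb
        (Homeomorph.measurableEmbedding _) (fun x ↦ f x.2.1)
    _ = μ.toSphere univ * ∫⁻ s : Ioi (0 : ℝ), f s ∂.volumeIoiPow (finrank ℝ E - 1) := by
      have := lintegral_prod_mul (μ := μ.toSphere)
        (ν := Measure.volumeIoiPow (finrank ℝ E - 1)) (f := fun _ ↦ 1) (g := fun s ↦ f s.1)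
        (by fun_prop) (by fun_prop)
      simpa using this
    _ = _ := by
      rw [μ.toSphere_apply_univ, Measure.volumeIoiPow,
        lintegral_withDensity_eq_lintegral_mul _ (by fun_prop) (by fun_prop)]
      congr 1
      exact lintegral_subtype_comap measurableSet_Ioi
        (fun s : ℝ ↦ ENNReal.ofReal (s ^ (finrank ℝ E - 1)) * f s)

theorem integrable_exp_neg_norm_sq_div_two (E : Type*) [NormedAddCommGroup E]
    [InnerProductSpace ℝ E] [FiniteDimensional ℝ E] [MeasurableSpace E] [BorelSpace E] :
    Integrable (fun x : E ↦ Real.exp (-‖x‖ ^ 2 / 2)) := by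
  have h := GaussianFourier.integrable_cexp_neg_mul_sq_norm_add (V := E) (b := 1 / 2)
    (by norm_num) 0 (0 : E)
  refine h.re.congr (.of_forall fun x ↦ ?_)
  simp only [zero_mul, add_zero]
  rw [show (-(1 / 2) * (‖x‖ : ℂ) ^ 2) = ((-‖x‖ ^ 2 / 2 : ℝ) : ℂ) by push_cast; ring]
  exact Complex.exp_ofReal_re _

/-- Both measures have characteristic function `exp (-‖t‖ ^ 2 / 2)`. -/
theorem stdGaussian_eq_withDensity (E : Type*) [NormedAddCommGroup E]
    [InnerProductSpace ℝ E] [FiniteDimensional ℝ E] [MeasurableSpace E] [BorelSpace E] :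
    stdGaussian E = (volume : Measure E).withDensity (fun x ↦
      ENNReal.ofReal ((2 * Real.pi) ^ (-(finrank ℝ E / 2 : ℝ)) * Real.exp (-‖x‖ ^ 2 / 2))) := by
  have hint := (integrable_exp_neg_norm_sq_div_two E).const_mul
    ((2 * Real.pi) ^ (-(finrank ℝ E / 2 : ℝ)))
  have := isFiniteMeasure_withDensity_ofReal hint.2
  apply Measure.ext_of_charFun
  ext t
  rw [charFun_stdGaussian, charFun_apply]
  rw [integral_withDensity_eq_integral_toReal_smul (by fun_prop) (by simp)]
  have h := GaussianFourier.integral_cexp_neg_mul_sq_norm_add (V := E) (b := 1 / 2)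
    (by norm_num) Complex.I t
  have hpi : (0 : ℝ) ≤ 2 * Real.pi := by positivity
  have key (x : E) : (ENNReal.ofReal ((2 * Real.pi) ^ (-(finrank ℝ E / 2 : ℝ)) *
      Real.exp (-‖x‖ ^ 2 / 2))).toReal • Complex.exp (inner ℝ x t * Complex.I) =
      (((2 * Real.pi) ^ (-(finrank ℝ E / 2 : ℝ)) : ℝ) : ℂ) *
        Complex.exp (-(1 / 2) * (‖x‖ : ℂ) ^ 2 + Complex.I * inner ℝ t x) := by
    rw [ENNReal.toReal_ofReal (by positivity), Complex.real_smul, Complex.ofReal_mul,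
      Complex.ofReal_exp, mul_assoc, ← Complex.exp_add, real_inner_comm]
    push_cast
    ring_nf
  simp_rw [key]
  rw [integral_const_mul, h, Complex.ofReal_cpow hpi, ← mul_assoc]
  push_cast
  rw [show (Real.pi : ℂ) / (1 / 2) = 2 * Real.pi by ring, ← Complex.cpow_add _ _ (by simp)]
  simp
  ring_nf

theorem stdGaussian_absolutelyContinuous (E : Type*) [NormedAddCommGroup E]
    [InnerProductSpace ℝ E] [FiniteDimensional ℝ E] [MeasurableSpace E] [BorelSpace E] :
    stdGaussian E ≪ volume := by
  rw [stdGaussian_eq_withDensity]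
  exact withDensity_absolutelyContinuous _ _

/-- The density on `(0, ∞)` of the chi distribution with `n` degrees of freedom, i.e. of the norm
of a standard Gaussian vector in dimension `n`. The formula is not cut off at `0`, so the
distribution is `volume.restrict (Ioi 0)` with this density; it is meaningful for `0 < n`. -/
noncomputable def chiDensity (n : ℕ) (s : ℝ) : ℝ :=
  (2 ^ ((n : ℝ) / 2 - 1) * Real.Gamma (n / 2))⁻¹ * (s ^ (n - 1) * Real.exp (-s ^ 2 / 2))

@[fun_prop]
theorem continuous_chiDensity (n : ℕ) : Continuous (chiDensity n) := by
  unfold chiDensity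
  fun_prop

theorem chiDensity_nonneg (n : ℕ) {s : ℝ} (hs : 0 ≤ s) : 0 ≤ chiDensity n s := by
  have : 0 ≤ Real.Gamma (n / 2) := Real.Gamma_nonneg_of_nonneg (by positivity)
  unfold chiDensity
  positivity

theorem lintegral_pow_mul_exp {n : ℕ} (hn : 0 < n) :
    ∫⁻ s in Ioi (0 : ℝ), ENNReal.ofReal (s ^ (n - 1) * Real.exp (-s ^ 2 / 2)) =
      ENNReal.ofReal (2 ^ ((n : ℝ) / 2 - 1) * Real.Gamma (n / 2)) := by
  have hn' : (1 : ℝ) ≤ n := by exact_mod_cast hn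
  have heq : EqOn (fun s : ℝ ↦ s ^ ((n : ℝ) - 1) * Real.exp (-(1 / 2) * s ^ (2 : ℝ)))
      (fun s ↦ s ^ (n - 1) * Real.exp (-s ^ 2 / 2)) (Ioi 0) := by
    intro s _
    simp only
    rw [← Real.rpow_natCast s (n - 1), Nat.cast_sub hn, Real.rpow_two, Nat.cast_one]
    ring_nf
  have hI := integral_rpow_mul_exp_neg_mul_rpow (p := 2) (q := n - 1) (b := 1 / 2)
    two_pos (by linarith) (by norm_num)
  have hint : IntegrableOn (fun s : ℝ ↦ s ^ ((n : ℝ) - 1) *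
      Real.exp (-(1 / 2) * s ^ (2 : ℝ))) (Ioi 0) :=
    integrableOn_rpow_mul_exp_neg_mul_rpow (by linarith) two_pos (by norm_num)
  rw [← ofReal_integral_eq_lintegral_ofReal (hint.congr_fun heq measurableSet_Ioi)
    ((ae_restrict_iff' measurableSet_Ioi).2 (.of_forall fun s (hs : 0 < s) ↦ by positivity)),
    ← setIntegral_congr_fun measurableSet_Ioi heq, hI]
  congr 1
  rw [sub_add_cancel, one_div, Real.inv_rpow two_pos.le, ← Real.rpow_neg two_pos.le, neg_div,
    neg_neg, Real.rpow_sub_one two_ne_zero]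
  ring

theorem lintegral_chiDensity {n : ℕ} (hn : 0 < n) :
    ∫⁻ s in Ioi (0 : ℝ), ENNReal.ofReal (chiDensity n s) = 1 := by
  have hn' : (0 : ℝ) < n / 2 := by positivity
  have hG : 0 < 2 ^ ((n : ℝ) / 2 - 1) * Real.Gamma (n / 2) :=
    mul_pos (by positivity) (Real.Gamma_pos_of_pos hn')
  simp_rw [chiDensity, ENNReal.ofReal_mul (inv_nonneg.2 hG.le)]
  rw [lintegral_const_mul _ (by fun_prop), lintegral_pow_mul_exp hn,
    ← ENNReal.ofReal_mul (inv_nonneg.2 hG.le), inv_mul_cancel₀ hG.ne', ENNReal.ofReal_one]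

/-- The norm of a standard Gaussian vector has the chi distribution. -/
theorem map_norm_stdGaussian (E : Type*) [NormedAddCommGroup E] [InnerProductSpace ℝ E]
    [FiniteDimensional ℝ E] [Nontrivial E] [MeasurableSpace E] [BorelSpace E] :
    (stdGaussian E).map (‖·‖) = (volume.restrict (Ioi (0 : ℝ))).withDensity
      (fun s ↦ ENNReal.ofReal (chiDensity (finrank ℝ E) s)) := by
  set n := finrank ℝ E with hn
  have hn0 : 0 < n := finrank_pos
  have hG : 0 < 2 ^ ((n : ℝ) / 2 - 1) * Real.Gamma (n / 2) :=
    mul_pos (by positivity) (Real.Gamma_pos_of_pos (by positivity))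
  -- The constant `k` involves the volume of the unit ball; that it equals `1` follows from comparing
  -- total masses, so the volume need not be known.
  obtain ⟨k, hk⟩ : ∃ k : ENNReal, ∀ g : ℝ → ENNReal, Measurable g →
      ∫⁻ x, g ‖x‖ ∂(stdGaussian E) =
        k * ∫⁻ s in Ioi (0 : ℝ), ENNReal.ofReal (chiDensity n s) * g s := by
    refine ⟨(n * volume (Metric.ball (0 : E) 1)) * ENNReal.ofReal ((2 * Real.pi) ^ (-(n / 2 : ℝ)) *
      (2 ^ ((n : ℝ) / 2 - 1) * Real.Gamma (n / 2))), fun g hg ↦ ?_⟩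
    rw [stdGaussian_eq_withDensity, lintegral_withDensity_eq_lintegral_mul _ (by fun_prop)
      (by fun_prop)]
    have h := lintegral_fun_norm_addHaar (volume : Measure E)
      (f := fun s ↦ ENNReal.ofReal ((2 * Real.pi) ^ (-(n / 2 : ℝ)) *
        Real.exp (-s ^ 2 / 2)) * g s) (by fun_prop)
    simp only [Pi.mul_apply]
    rw [h, ← hn, mul_assoc (_ * _) (ENNReal.ofReal _)]
    congr 1
    rw [← lintegral_const_mul _ (by fun_prop)]
    refine setLIntegral_congr_fun measurableSet_Ioi fun s (hs : 0 < s) ↦ ?_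
    simp only [← mul_assoc]
    rw [← ENNReal.ofReal_mul (by positivity), ← ENNReal.ofReal_mul (by positivity)]
    congr 2
    unfold chiDensity
    field_simp
  have hk1 : k = 1 := by
    have := hk (fun _ ↦ 1) measurable_const
    simpa [lintegral_chiDensity hn0] using this.symm
  refine Measure.ext_of_lintegral _ fun g hg ↦ ?_
  rw [lintegral_map hg measurable_norm, hk g hg, hk1, one_mul,
    lintegral_withDensity_eq_lintegral_mul _ (by fun_prop) hg]
  rfl

/-! ### Two independent chi variables -/

/-- The probability that a standard Gaussian vector in dimension `k + m` makes an angle less than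
`arcsin r` with a fixed `k`-dimensional subspace, where `0 < k`, `0 < m` and `0 < r < 1`. In terms of
the regularized incomplete beta function it is `I_{r ^ 2} (m / 2, k / 2)`. -/
noncomputable def sectorProb (k m : ℕ) (r : ℝ) : ℝ :=
  2 * Real.Gamma (((k : ℝ) + m) / 2) / (Real.Gamma (k / 2) * Real.Gamma (m / 2)) *
    ∫ θ in (0 : ℝ)..Real.arcsin r, Real.sin θ ^ (m - 1) * Real.cos θ ^ (k - 1)

/-- In polar coordinates, with the Jacobian `ρ`, the joint density of two independent chi variables
factors into a chi density in `ρ` and a density in the angle `θ`. -/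
theorem mul_chiDensity_mul_chiDensity {k m : ℕ} (hk : 0 < k) (hm : 0 < m) (ρ θ : ℝ) :
    ρ * (chiDensity k (ρ * Real.cos θ) * chiDensity m (ρ * Real.sin θ)) =
      chiDensity (k + m) ρ * (2 * Real.Gamma (((k : ℝ) + m) / 2) /
        (Real.Gamma (k / 2) * Real.Gamma (m / 2)) *
        (Real.sin θ ^ (m - 1) * Real.cos θ ^ (k - 1))) := by
  have hk' : 0 < Real.Gamma ((k : ℝ) / 2) := Real.Gamma_pos_of_pos (by positivity)
  have hm' : 0 < Real.Gamma ((m : ℝ) / 2) := Real.Gamma_pos_of_pos (by positivity)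
  have hkm : 0 < Real.Gamma (((k : ℝ) + m) / 2) := Real.Gamma_pos_of_pos (by positivity)
  have hexp : Real.exp (-ρ ^ 2 / 2) =
      Real.exp (-(ρ * Real.cos θ) ^ 2 / 2) * Real.exp (-(ρ * Real.sin θ) ^ 2 / 2) := by
    rw [← Real.exp_add]
    congr 1
    linear_combination (ρ ^ 2 / 2) * Real.sin_sq_add_cos_sq θ
  have h2 : (2 : ℝ) ^ (((k : ℝ) + m) / 2 - 1) =
      2 * (2 ^ ((k : ℝ) / 2 - 1) * 2 ^ ((m : ℝ) / 2 - 1)) := by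
    rw [← Real.rpow_add two_pos, mul_comm, ← Real.rpow_add_one two_ne_zero]
    ring_nf
  have hρ : ρ ^ (k + m - 1) = ρ * (ρ ^ (k - 1) * ρ ^ (m - 1)) := by
    rw [← pow_add, ← pow_succ']
    congr 1
    omega
  unfold chiDensity
  rw [hexp, hρ]
  push_cast
  rw [h2, mul_pow ρ _ (k - 1), mul_pow ρ _ (m - 1)]
  field_simp

/-- For independent chi variables `S`, `T` with `k` and `m` degrees of freedom, the event
`T < r * √(S ^ 2 + T ^ 2)` is, in polar coordinates, the sector `0 < θ < arcsin r`. -/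
theorem ofReal_sectorProb_le {k m : ℕ} (hk : 0 < k) (hm : 0 < m) {r : ℝ} (hr0 : 0 < r)
    (hr1 : r < 1) :
    ENNReal.ofReal (sectorProb k m r) ≤
      ((volume.restrict (Ioi (0 : ℝ))).withDensity fun s ↦ ENNReal.ofReal (chiDensity k s)).prod
        ((volume.restrict (Ioi (0 : ℝ))).withDensity fun s ↦ ENNReal.ofReal (chiDensity m s))
        {p | p.2 < r * √(p.1 ^ 2 + p.2 ^ 2)} := by
  have hS : MeasurableSet {p : ℝ × ℝ | p.2 < r * √(p.1 ^ 2 + p.2 ^ 2)} :=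
    measurableSet_lt (by fun_prop) (by fun_prop)
  have hα0 : 0 < Real.arcsin r := Real.arcsin_pos.2 hr0
  have hα1 : Real.arcsin r < Real.pi / 2 := Real.arcsin_lt_pi_div_two.2 hr1
  have hpi := Real.pi_pos
  rw [prod_withDensity (by fun_prop) (by fun_prop), Measure.prod_restrict,
    withDensity_apply _ hS, Measure.restrict_restrict hS,
    ← lintegral_indicator (hS.inter (measurableSet_Ioi.prod measurableSet_Ioi)),
    ← Measure.volume_eq_prod, ← lintegral_comp_polarCoord_symm]
  have hsub : Ioi (0 : ℝ) ×ˢ Ioo (0 : ℝ) (Real.arcsin r) ⊆ polarCoord.target :=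
    prod_mono_right (Ioo_subset_Ioo (by linarith) (by linarith))
  refine le_trans ?_ (lintegral_mono_set hsub)
  set C := 2 * Real.Gamma (((k : ℝ) + m) / 2) / (Real.Gamma (k / 2) * Real.Gamma (m / 2)) with hC
  have hC0 : 0 ≤ C := by
    have := Real.Gamma_nonneg_of_nonneg (s := ((k : ℝ) + m) / 2) (by positivity)
    have := Real.Gamma_nonneg_of_nonneg (s := (k : ℝ) / 2) (by positivity)
    have := Real.Gamma_nonneg_of_nonneg (s := (m : ℝ) / 2) (by positivity)
    positivity
  have hcongr : ∀ p ∈ Ioi (0 : ℝ) ×ˢ Ioo (0 : ℝ) (Real.arcsin r),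
      ENNReal.ofReal p.1 • ({p : ℝ × ℝ | p.2 < r * √(p.1 ^ 2 + p.2 ^ 2)} ∩
        Ioi 0 ×ˢ Ioi 0).indicator (fun z : ℝ × ℝ ↦ ENNReal.ofReal (chiDensity k z.1) *
          ENNReal.ofReal (chiDensity m z.2)) (polarCoord.symm p) =
      ENNReal.ofReal (chiDensity (k + m) p.1) *
        ENNReal.ofReal (C * (Real.sin p.2 ^ (m - 1) * Real.cos p.2 ^ (k - 1))) := by
    rintro ⟨ρ, θ⟩ ⟨hρ, hθ0, hθ1⟩
    simp only [mem_Ioi] at hρ hθ0 hθ1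
    have hsin : 0 < Real.sin θ := Real.sin_pos_of_pos_of_lt_pi hθ0 (by linarith)
    have hcos : 0 < Real.cos θ := Real.cos_pos_of_mem_Ioo ⟨by linarith, by linarith⟩
    have hlt : Real.sin θ < r := (Real.lt_arcsin_iff_sin_lt' ⟨by linarith, by linarith⟩).1 hθ1
    rw [polarCoord_symm_apply, indicator_of_mem]
    · simp only [smul_eq_mul]
      rw [← ENNReal.ofReal_mul (chiDensity_nonneg _ (by positivity)), ← ENNReal.ofReal_mul hρ.le,
        mul_chiDensity_mul_chiDensity hk hm, ENNReal.ofReal_mul (chiDensity_nonneg _ hρ.le)]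
    · refine ⟨?_, mul_pos hρ hcos, mul_pos hρ hsin⟩
      have : (ρ * Real.cos θ) ^ 2 + (ρ * Real.sin θ) ^ 2 = ρ ^ 2 := by
        linear_combination (ρ ^ 2) * Real.sin_sq_add_cos_sq θ
      simp only [mem_ofPred_eq, this, Real.sqrt_sq hρ.le]
      nlinarith
  rw [setLIntegral_congr_fun (measurableSet_Ioi.prod measurableSet_Ioo) hcongr,
    Measure.volume_eq_prod, ← Measure.prod_restrict,
    lintegral_prod_mul (f := fun ρ ↦ ENNReal.ofReal (chiDensity (k + m) ρ))
      (g := fun θ ↦ ENNReal.ofReal (C * (Real.sin θ ^ (m - 1) * Real.cos θ ^ (k - 1))))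
      (by fun_prop) (by fun_prop), lintegral_chiDensity (by omega), one_mul,
    sectorProb, ← hC, ← intervalIntegral.integral_const_mul,
    intervalIntegral.integral_of_le hα0.le, integral_Ioc_eq_integral_Ioo,
    ofReal_integral_eq_lintegral_ofReal]
  · exact ((by fun_prop : Continuous fun θ ↦ C * (Real.sin θ ^ (m - 1) *
      Real.cos θ ^ (k - 1))).integrableOn_Icc).mono_set Ioo_subset_Icc_self
  · refine (ae_restrict_iff' measurableSet_Ioo).2 (.of_forall fun θ hθ ↦ ?_)
    have hsin := (Real.sin_pos_of_pos_of_lt_pi hθ.1 (by linarith [hθ.2])).le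
    have hcos : 0 ≤ Real.cos θ :=
      (Real.cos_pos_of_mem_Ioo ⟨by linarith [hθ.1], by linarith [hθ.2]⟩).le
    simp only [Pi.zero_apply]
    positivity

/-! ### Projections and spans of Gaussian vectors -/

section
variable {E : Type*} [NormedAddCommGroup E] [InnerProductSpace ℝ E] [FiniteDimensional ℝ E]
  [MeasurableSpace E] [BorelSpace E]

/-- The components of a standard Gaussian vector along `W` and `Wᗮ` are independent standard
Gaussian vectors. -/
theorem map_orthogonalProjection_stdGaussian (W : Submodule ℝ E) :
    (stdGaussian E).map (fun x ↦ (W.orthogonalProjectionOnto x, Wᗮ.orthogonalProjectionOnto x)) =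
      (stdGaussian W).prod (stdGaussian Wᗮ) := by
  apply (MeasurableEquiv.toLp 2 (W × Wᗮ)).map_measurableEquiv_injective
  simp only [MeasurableEquiv.coe_toLp]
  rw [Measure.map_map (by fun_prop) (by fun_prop)]
  have : (WithLp.toLp 2 ∘ fun x : E ↦
      (W.orthogonalProjectionOnto x, Wᗮ.orthogonalProjectionOnto x)) =
      W.orthogonalDecomposition := by
    ext1 x
    exact (W.orthogonalDecomposition_apply x).symm
  rw [this, stdGaussian_map]
  apply Measure.ext_of_charFun
  ext t
  rw [charFun_prod, charFun_stdGaussian, charFun_stdGaussian, charFun_stdGaussian,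
    ← Complex.exp_add, ← Complex.ofReal_pow, WithLp.prod_norm_sq_eq_of_L2]
  push_cast
  congr 1
  simp
  ring

theorem map_norm_orthogonalProjection_stdGaussian (W : Submodule ℝ E) [Nontrivial W]
    [Nontrivial Wᗮ] :
    (stdGaussian E).map
        (fun x ↦ (‖W.orthogonalProjectionOnto x‖, ‖Wᗮ.orthogonalProjectionOnto x‖)) =
      ((volume.restrict (Ioi (0 : ℝ))).withDensity
          fun s ↦ ENNReal.ofReal (chiDensity (finrank ℝ W) s)).prod
        ((volume.restrict (Ioi (0 : ℝ))).withDensity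
          fun s ↦ ENNReal.ofReal (chiDensity (finrank ℝ Wᗮ) s)) := by
  rw [← map_norm_stdGaussian W, ← map_norm_stdGaussian Wᗮ,
    Measure.map_prod_map _ _ measurable_norm measurable_norm,
    ← map_orthogonalProjection_stdGaussian W, Measure.map_map (by fun_prop) (by fun_prop)]
  rfl

theorem ofReal_sectorProb_le_stdGaussian {k m : ℕ} (hk : 0 < k) (hm : 0 < m)
    (hE : finrank ℝ E = k + m) (W : Submodule ℝ E) (hW : finrank ℝ W = k) {r : ℝ} (hr0 : 0 < r)
    (hr1 : r < 1) :
    ENNReal.ofReal (sectorProb k m r) ≤ stdGaussian E {x | ∃ w ∈ W, ‖w - x‖ < r * ‖x‖} := by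
  have hW' : finrank ℝ Wᗮ = m := by
    have := W.finrank_add_finrank_orthogonal
    omega
  have : Nontrivial W := nontrivial_of_finrank_pos (R := ℝ) (by omega)
  have : Nontrivial Wᗮ := nontrivial_of_finrank_pos (R := ℝ) (by omega)
  refine (ofReal_sectorProb_le hk hm hr0 hr1).trans ?_
  have h := map_norm_orthogonalProjection_stdGaussian W
  rw [hW, hW'] at h
  rw [← h, Measure.map_apply (by fun_prop) (measurableSet_lt (by fun_prop) (by fun_prop))]
  refine measure_mono fun x hx ↦ ⟨W.starProjection x, W.starProjection_apply_mem x, ?_⟩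
  simp only [mem_preimage, mem_ofPred_eq] at hx
  rw [← W.norm_sq_eq_add_norm_sq_projection, Real.sqrt_sq (norm_nonneg x)] at hx
  rwa [norm_sub_rev, ← W.starProjection_orthogonal_val x]

/-- At most `finrank ℝ E` independent standard Gaussian vectors are almost surely linearly
independent: each new vector avoids the span of the others, a proper subspace and so a null set. -/
theorem ae_linearIndependent_pi_stdGaussian {d : ℕ} (hd : d ≤ finrank ℝ E) :
    ∀ᵐ B ∂Measure.pi (fun _ : Fin d ↦ stdGaussian E), LinearIndependent ℝ B := by
  induction d with
  | zero => exact .of_forall fun B ↦ linearIndependent_empty_type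
  | succ d ih =>
    have hmp := (measurePreserving_piFinSuccAbove (fun _ : Fin (d + 1) ↦ stdGaussian E) 0).symm
    have hmeas := (isOpen_setOfPred_linearIndependent (𝕜 := ℝ) (E := E)
      (ι := Fin (d + 1))).measurableSet
    have hmeas' : MeasurableSet {q : E × (Fin d → E) | LinearIndependent ℝ
      ((MeasurableEquiv.piFinSuccAbove (fun _ ↦ E) 0).symm (q.1, q.2))} := hmp.measurable hmeas
    rw [← hmp.map_eq, ae_map_iff hmp.aemeasurable hmeas]
    refine (Measure.ae_prod_iff_ae_ae hmeas').2 ((Measure.ae_ae_comm hmeas').2 ?_)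
    filter_upwards [ih (by omega)] with B hB
    have hspan : Submodule.span ℝ (range B) ≠ ⊤ := by
      intro htop
      have := finrank_range_le_card (R := ℝ) B
      rw [Set.finrank, htop, finrank_top, Fintype.card_fin] at this
      omega
    have hnull := stdGaussian_absolutelyContinuous E
      (Measure.addHaar_submodule volume _ hspan)
    filter_upwards [measure_eq_zero_iff_ae_notMem.1 hnull] with x hx
    have hcons : (MeasurableEquiv.piFinSuccAbove (fun _ ↦ E) 0).symm (x, B) =
        (Fin.cons x B : Fin (d + 1) → E) := Fin.insertNth_zero (α := fun _ ↦ E) x B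
    rw [hcons]
    exact linearIndependent_finCons.2 ⟨hB, hx⟩
end

/-! ### Nearness of a vector to a Gaussian span -/

section
variable {E : Type*} [NormedAddCommGroup E] [InnerProductSpace ℝ E]

/-- Some linear combination of the family `B` is at distance less than `r * ‖u‖` from `u`. For
`u ≠ 0` and `0 < r < 1`, this says that the angle between `u` and the span of `B` is less than
`arcsin r`. It is false for `u = 0`. -/
def IsNearSpan {ι : Type*} [Fintype ι] (r : ℝ) (B : ι → E) (u : E) : Prop :=
  ∃ y : ι → ℝ, ‖∑ j, y j • B j - u‖ < r * ‖u‖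

theorem isOpen_setOf_isNearSpan (ι : Type*) [Fintype ι] (r : ℝ) :
    IsOpen {q : (ι → E) × E | IsNearSpan r q.1 q.2} := by
  simp only [IsNearSpan, ofPred_exists]
  exact isOpen_iUnion fun y ↦ isOpen_lt (by fun_prop) (by fun_prop)

theorem isNearSpan_iff_exists_mem_span {ι : Type*} [Fintype ι] {r : ℝ} {B : ι → E} {u : E} :
    IsNearSpan r B u ↔ ∃ w ∈ Submodule.span ℝ (range B), ‖w - u‖ < r * ‖u‖ := by
  simp only [IsNearSpan, Submodule.mem_span_range_iff_exists_fun, exists_exists_eq_and]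

theorem isNearSpan_smul_iff {ι : Type*} [Fintype ι] {r c : ℝ} (hc : c ≠ 0) {B : ι → E} {u : E} :
    IsNearSpan r B (c • u) ↔ IsNearSpan r B u := by
  rw [isNearSpan_iff_exists_mem_span, isNearSpan_iff_exists_mem_span]
  have hc' : 0 < ‖c‖ := norm_pos_iff.2 hc
  constructor
  · rintro ⟨w, hw, h⟩
    refine ⟨c⁻¹ • w, Submodule.smul_mem _ _ hw, ?_⟩
    rw [← mul_lt_mul_iff_right₀ hc', ← norm_smul, smul_sub, smul_inv_smul₀ hc]
    rw [norm_smul] at h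
    linarith
  · rintro ⟨w, hw, h⟩
    refine ⟨c • w, Submodule.smul_mem _ _ hw, ?_⟩
    rw [← smul_sub, norm_smul, norm_smul]
    nlinarith

theorem isNearSpan_map_iff {ι : Type*} [Fintype ι] {r : ℝ} (Q : E ≃ₗᵢ[ℝ] E) {B : ι → E} {u : E} :
    IsNearSpan r (fun j ↦ Q (B j)) (Q u) ↔ IsNearSpan r B u := by
  simp only [IsNearSpan, ← map_smul, ← map_sum, ← map_sub, Q.norm_map]

variable [FiniteDimensional ℝ E] [MeasurableSpace E] [BorelSpace E]

/-- By invariance under scaling of `u` and under isometries of the whole picture, the probability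
that `u` is near the span of independent standard Gaussian vectors does not depend on `u ≠ 0`. -/
theorem measure_isNearSpan_eq {ι : Type*} [Fintype ι] (r : ℝ) {u v : E} (hu : u ≠ 0)
    (hv : v ≠ 0) :
    Measure.pi (fun _ : ι ↦ stdGaussian E) {B | IsNearSpan r B u} =
      Measure.pi (fun _ : ι ↦ stdGaussian E) {B | IsNearSpan r B v} := by
  have hu' : 0 < ‖u‖ := norm_pos_iff.2 hu
  have hv' : 0 < ‖v‖ := norm_pos_iff.2 hv
  -- Rescale `u` to the norm of `v`, and reflect it onto `v`.
  set c : ℝ := ‖v‖ / ‖u‖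
  have hc : 0 < c := by positivity
  have hcu : ‖c • u‖ = ‖v‖ := by
    rw [norm_smul, Real.norm_of_nonneg hc.le, div_mul_cancel₀ _ hu'.ne']
  set Q : E ≃ₗᵢ[ℝ] E := (ℝ ∙ (c • u - v))ᗮ.reflection
  have hQ : Q (c • u) = v := Submodule.reflection_sub hcu
  have hmp : MeasurePreserving (fun (B : ι → E) j ↦ Q (B j))
      (Measure.pi fun _ ↦ stdGaussian E) (Measure.pi fun _ ↦ stdGaussian E) :=
    measurePreserving_pi _ _ fun _ ↦ ⟨Q.continuous.measurable, stdGaussian_map Q⟩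
  have hmeas : MeasurableSet {B : ι → E | IsNearSpan r B v} :=
    ((isOpen_setOf_isNearSpan ι r).preimage
      (by fun_prop : Continuous fun B : ι → E ↦ (B, v))).measurableSet
  rw [← hmp.measure_preimage hmeas.nullMeasurableSet]
  congr 1 with B
  simp only [mem_preimage, mem_ofPred_eq]
  rw [← hQ, isNearSpan_map_iff, isNearSpan_smul_iff hc.ne']

/-- The fixed vector `u` is replaced by an independent standard Gaussian vector `x`. After exchanging
the integrals the span is fixed, almost surely of dimension `d`, and `x` is random. -/
theorem ofReal_sectorProb_le_measure_isNearSpan {d m : ℕ} (hd : 0 < d) (hm : 0 < m)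
    (hE : finrank ℝ E = d + m) {r : ℝ} (hr0 : 0 < r) (hr1 : r < 1) {u : E} (hu : u ≠ 0) :
    ENNReal.ofReal (sectorProb d m r) ≤
      Measure.pi (fun _ : Fin d ↦ stdGaussian E) {B | IsNearSpan r B u} := by
  set ν := Measure.pi (fun _ : Fin d ↦ stdGaussian E) with hν
  have : Nontrivial E := nontrivial_of_finrank_pos (R := ℝ) (by omega)
  have hS := (isOpen_setOf_isNearSpan (E := E) (Fin d) r).measurableSet
  have hne : ∀ᵐ x ∂stdGaussian E, x ≠ 0 :=
    (stdGaussian_absolutelyContinuous E).ae_le (Measure.ae_ne volume 0)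
  calc
    ENNReal.ofReal (sectorProb d m r) = ∫⁻ _, ENNReal.ofReal (sectorProb d m r) ∂ν := by simp
    _ ≤ ∫⁻ B, stdGaussian E {x | IsNearSpan r B x} ∂ν := by
      refine lintegral_mono_ae ?_
      filter_upwards [ae_linearIndependent_pi_stdGaussian (E := E) (d := d) (by omega)] with B hB
      simp only [isNearSpan_iff_exists_mem_span]
      exact ofReal_sectorProb_le_stdGaussian hd hm hE _ (by simpa using finrank_span_eq_card hB)
        hr0 hr1
    _ = ν.prod (stdGaussian E) {q | IsNearSpan r q.1 q.2} := (Measure.prod_apply hS).symm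
    _ = ∫⁻ x, ν {B | IsNearSpan r B x} ∂stdGaussian E := Measure.prod_apply_symm hS
    _ = ∫⁻ _, ν {B | IsNearSpan r B u} ∂stdGaussian E := by
      refine lintegral_congr_ae ?_
      filter_upwards [hne] with x hx
      exact measure_isNearSpan_eq r hx hu
    _ = ν {B | IsNearSpan r B u} := by simp

end

/-! ### Reduced problems -/

/-- For `d = 1` this is an equality. For `2 ≤ d` the integrand of `sectorProb` is bounded below by
`sin θ ^ (m - 1) * cos θ * cos (arcsin r) ^ (d - 2)`, whose integral is explicit. -/
theorem tau_le_sectorProb {d m : ℕ} (hd : 0 < d) (hm : 0 < m) {r : ℝ} (hr0 : 0 < r)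
    (hr1 : r < 1) : tau r d (d + m) ≤ sectorProb d m r := by
  have hd' : (0 : ℝ) < d := by positivity
  have hm' : (0 : ℝ) < m := by positivity
  have hGd : 0 < Real.Gamma ((d : ℝ) / 2) := Real.Gamma_pos_of_pos (by positivity)
  have hGm : 0 < Real.Gamma ((m : ℝ) / 2) := Real.Gamma_pos_of_pos (by positivity)
  have hGdm : 0 < Real.Gamma (((d : ℝ) + m) / 2) := Real.Gamma_pos_of_pos (by positivity)
  have hGm1 : Real.Gamma ((m : ℝ) / 2 + 1) = m / 2 * Real.Gamma (m / 2) :=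
    Real.Gamma_add_one (by positivity)
  have hbinom : gammaBinom (((d : ℝ) + m - 2) / 2) (m / 2) =
      2 * Real.Gamma (((d : ℝ) + m) / 2) / (Real.Gamma (d / 2) * Real.Gamma (m / 2)) / m := by
    rw [gammaBinom, show ((d : ℝ) + m - 2) / 2 + 1 = (d + m) / 2 by ring,
      show ((d : ℝ) + m - 2) / 2 - m / 2 + 1 = d / 2 by ring, hGm1]
    field_simp
  unfold tau sectorProb
  push_cast
  split_ifs with h1
  · subst h1
    push_cast at hbinom ⊢
    rw [add_sub_cancel_left, hbinom, mul_div_cancel₀ _ hm'.ne',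
      show 1 + m - 2 = m - 1 by omega]
    simp
  · have hd2 : 2 ≤ d := by omega
    rw [add_sub_cancel_left, add_tsub_cancel_left, hbinom]
    set C := 2 * Real.Gamma (((d : ℝ) + m) / 2) / (Real.Gamma (d / 2) * Real.Gamma (m / 2))
    have hα0 : 0 ≤ Real.arcsin r := Real.arcsin_nonneg.2 hr0.le
    have hα1 := Real.arcsin_le_pi_div_two r
    have hpi := Real.pi_pos
    have hpow : (1 - r ^ 2) ^ (((d : ℝ) - 2) / 2) = Real.cos (Real.arcsin r) ^ (d - 2) := by
      rw [Real.cos_arcsin, Real.sqrt_eq_rpow, ← Real.rpow_mul_natCast (by nlinarith),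
        Nat.cast_sub hd2]
      congr 1
      push_cast
      ring
    have hint : ∫ θ in (0 : ℝ)..Real.arcsin r, Real.sin θ ^ (m - 1) * Real.cos θ = r ^ m / m := by
      have := integral_sin_pow_mul_cos_pow_odd (a := 0) (b := Real.arcsin r) (m - 1) 0
      simp only [mul_zero, zero_add, pow_one, pow_zero, mul_one, Real.sin_zero,
        Real.sin_arcsin (by linarith) hr1.le, integral_pow, Nat.sub_add_cancel hm] at this
      rw [this, zero_pow hm.ne', Nat.cast_sub hm]
      simp
    have hmono : r ^ m / m * Real.cos (Real.arcsin r) ^ (d - 2) ≤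
        ∫ θ in (0 : ℝ)..Real.arcsin r, Real.sin θ ^ (m - 1) * Real.cos θ ^ (d - 1) := by
      rw [← hint, ← intervalIntegral.integral_mul_const]
      refine intervalIntegral.integral_mono_on hα0
        (Continuous.intervalIntegrable (by fun_prop) _ _)
        (Continuous.intervalIntegrable (by fun_prop) _ _) fun θ hθ ↦ ?_
      have hsin := Real.sin_nonneg_of_nonneg_of_le_pi hθ.1 (by linarith [hθ.2])
      have hcos : 0 ≤ Real.cos θ :=
        Real.cos_nonneg_of_neg_pi_div_two_le_of_le (by linarith [hθ.1]) (by linarith [hθ.2])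
      have hle : Real.cos (Real.arcsin r) ≤ Real.cos θ :=
        Real.cos_le_cos_of_nonneg_of_le_pi hθ.1 (by linarith) hθ.2
      rw [show d - 1 = d - 2 + 1 by omega, pow_succ', mul_assoc]
      gcongr
      exact Real.cos_arcsin_nonneg r
    rw [hpow]
    calc C / m * r ^ m * Real.cos (Real.arcsin r) ^ (d - 2)
        = C * (r ^ m / m * Real.cos (Real.arcsin r) ^ (d - 2)) := by ring
      _ ≤ _ := by gcongr

/-- The columns of a Gaussian matrix are independent standard Gaussian vectors. -/
theorem IsGaussianMatrix.hasLaw_columns {Ω : Type*} [MeasurableSpace Ω] {P : Measure Ω}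
    {D d : ℕ} {A : Ω → Matrix (Fin D) (Fin d) ℝ} (hA : IsGaussianMatrix A P) :
    HasLaw (fun ω j ↦ (WithLp.toLp 2 fun i ↦ A ω i j : EuclideanSpace ℝ (Fin D)))
      (Measure.pi fun _ : Fin d ↦ stdGaussian (EuclideanSpace ℝ (Fin D))) P := by
  have hlaw : HasLaw (fun ω (ji : Fin d × Fin D) ↦ A ω ji.2 ji.1)
      (Measure.pi fun _ ↦ gaussianReal 0 1) P :=
    (hA.iIndepFun_entries.precomp Prod.swap_injective).hasLaw_pi
      fun ji ↦ hA.hasLaw_entry ji.2 ji.1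
  have hcurry : HasLaw (MeasurableEquiv.curry (Fin d) (Fin D) ℝ)
      (Measure.pi fun _ : Fin d ↦ Measure.pi fun _ : Fin D ↦ gaussianReal 0 1)
      (Measure.pi fun _ : Fin d × Fin D ↦ gaussianReal 0 1) := by
    refine ⟨(MeasurableEquiv.measurable _).aemeasurable, ?_⟩
    have := Measure.infinitePi_map_curry (fun (_ : Fin d) (_ : Fin D) ↦ gaussianReal 0 1)
    simpa only [Measure.infinitePi_eq_pi] using this
  have htoLp : HasLaw (fun (B : Fin d → Fin D → ℝ) j ↦ WithLp.toLp 2 (B j))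
      (Measure.pi fun _ ↦ stdGaussian (EuclideanSpace ℝ (Fin D)))
      (Measure.pi fun _ : Fin d ↦ Measure.pi fun _ : Fin D ↦ gaussianReal 0 1) := by
    refine ⟨(measurable_pi_lambda _ fun j ↦
      (WithLp.measurable_toLp 2 _).comp (measurable_pi_apply j)).aemeasurable, ?_⟩
    have : SigmaFinite ((Measure.pi fun _ : Fin D ↦ gaussianReal 0 1).map (WithLp.toLp 2)) := by
      rw [map_pi_eq_stdGaussian]
      infer_instance
    rw [Measure.pi_map_pi (fun _ ↦ by fun_prop), map_pi_eq_stdGaussian]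
  exact (htoLp.comp hcurry).comp hlaw

/-- If the affine subspace `p + range A` meets the ball of radius `ε / L` around the minimizer, the
reduced problem is `ε`-successful. -/
theorem reducedProblemSuccessful_of_norm_sub_lt {D d : ℕ} {X : Set (EuclideanSpace ℝ (Fin D))}
    {f : EuclideanSpace ℝ (Fin D) → ℝ} {L : ℝ≥0} (hL : 0 < L) (hf : LipschitzOnWith L f X)
    {ε : ℝ} {xstar : EuclideanSpace ℝ (Fin D)} (hmin : IsGlobalMinimizer f X xstar)
    (hball : Metric.ball xstar (ε / L) ⊆ X) {A : Matrix (Fin D) (Fin d) ℝ}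
    {p : EuclideanSpace ℝ (Fin D)} {y : Fin d → ℝ}
    (hy : ‖WithLp.toLp 2 (A *ᵥ y) - (xstar - p)‖ < ε / L) :
    ReducedProblemSuccessful f X A p ε := by
  have hdist : dist (WithLp.toLp 2 (A *ᵥ y) + p) xstar < ε / L := by
    rwa [dist_eq_norm, ← sub_sub_eq_add_sub]
  have hmem := hball hdist
  have hopt : optimalValue f X = f xstar :=
    (show IsLeast (f '' X) (f xstar) from ⟨mem_image_of_mem f hmin.1,
      forall_mem_image.2 fun x hx ↦ hmin.2 hx⟩).csInf_eq
  refine ⟨y, hmem, ?_⟩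
  have hLip := (le_abs_self _).trans (hf.dist_le_mul _ hmem _ hmin.1)
  have : (L : ℝ) * dist (WithLp.toLp 2 (A *ᵥ y) + p) xstar ≤ ε := by
    rw [mul_comm]
    exact ((lt_div_iff₀ (by exact_mod_cast hL)).1 hdist).le
  rw [hopt]
  linarith

theorem toLp_mulVec_eq_sum {D d : ℕ} (A : Matrix (Fin D) (Fin d) ℝ) (y : Fin d → ℝ) :
    (WithLp.toLp 2 (A *ᵥ y) : EuclideanSpace ℝ (Fin D)) =
      ∑ j, y j • WithLp.toLp 2 fun i ↦ A i j := by
  ext i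
  simp [Matrix.mulVec, dotProduct, mul_comm]

end

theorem mainTheorem2 {Ω : Type*} [MeasurableSpace Ω] (P : Measure Ω) [IsProbabilityMeasure P]
    {D d : ℕ} (hd : 1 ≤ d) (hdD : d < D)
    (X : Set (EuclideanSpace ℝ (Fin D))) (f : EuclideanSpace ℝ (Fin D) → ℝ)
    (L : ℝ≥0) (hL : 0 < L) (hf : LipschitzOnWith L f X)
    (A : Ω → Matrix (Fin D) (Fin d) ℝ) (hA : IsGaussianMatrix A P)
    (ε : ℝ) (hε : 0 < ε)
    (xstar : EuclideanSpace ℝ (Fin D)) (hmin : IsGlobalMinimizer f X xstar)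
    (hball : Metric.ball xstar (ε / L) ⊆ X)
    (Rmax : ℝ) (hR : 0 < Rmax) (hr : ε / (L * Rmax) < 1) :
    ∀ p ∈ X, ‖p - xstar‖ < Rmax →
      P.real {ω | ReducedProblemSuccessful f X (A ω) p ε} ≥ tau (ε / (L * Rmax)) d D := by
  intro p _ hp
  have hL' : (0 : ℝ) < L := by exact_mod_cast hL
  set r := ε / (L * Rmax) with hr_def
  have hr0 : 0 < r := by positivity
  obtain ⟨m, rfl⟩ := Nat.exists_eq_add_of_le hdD.le
  have hm : 0 < m := by omega
  have : Nonempty (Fin (d + m)) := ⟨⟨0, by omega⟩⟩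
  obtain ⟨u, hu, hsub⟩ : ∃ u : EuclideanSpace ℝ (Fin (d + m)), u ≠ 0 ∧
      {ω | IsNearSpan r (fun j ↦ (WithLp.toLp 2 fun i ↦ A ω i j :
        EuclideanSpace ℝ (Fin (d + m)))) u} ⊆ {ω | ReducedProblemSuccessful f X (A ω) p ε} := by
    -- The direction to test is `xstar - p`. If it vanishes, `y = 0` always succeeds, and any `u ≠ 0`
    -- serves.
    by_cases h0 : xstar - p = 0
    · obtain ⟨u, hu⟩ := exists_ne (0 : EuclideanSpace ℝ (Fin (d + m)))
      refine ⟨u, hu, fun ω _ ↦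
        reducedProblemSuccessful_of_norm_sub_lt hL hf hmin hball (y := 0) ?_⟩
      rw [h0, Matrix.mulVec_zero, WithLp.toLp_zero, sub_zero, norm_zero]
      positivity
    · refine ⟨xstar - p, h0, ?_⟩
      rintro ω ⟨y, hy⟩
      refine reducedProblemSuccessful_of_norm_sub_lt hL hf hmin hball (y := y) ?_
      rw [toLp_mulVec_eq_sum]
      refine hy.trans ?_
      rw [norm_sub_rev, show ε / L = r * Rmax by rw [hr_def]; field_simp]
      gcongr
  have hopen : MeasurableSet {B : Fin d → EuclideanSpace ℝ (Fin (d + m)) | IsNearSpan r B u} :=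
    ((isOpen_setOf_isNearSpan (Fin d) r).preimage
      (by fun_prop : Continuous fun B : Fin d → EuclideanSpace ℝ (Fin (d + m)) ↦
        (B, u))).measurableSet
  refine (tau_le_sectorProb hd hm hr0 hr).trans ?_
  rw [measureReal_def, ← ENNReal.ofReal_le_iff_le_toReal (measure_ne_top _ _)]
  calc ENNReal.ofReal (sectorProb d m r)
      ≤ Measure.pi (fun _ : Fin d ↦ stdGaussian (EuclideanSpace ℝ (Fin (d + m))))
          {B | IsNearSpan r B u} :=
        ofReal_sectorProb_le_measure_isNearSpan hd hm finrank_euclideanSpace_fin hr0 hr hu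
    _ = P {ω | IsNearSpan r (fun j ↦ (WithLp.toLp 2 fun i ↦ A ω i j :
        EuclideanSpace ℝ (Fin (d + m)))) u} := (hA.hasLaw_columns.measure_eq hopen).symm
    _ ≤ _ := measure_mono hsub
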